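/- Let $m,n\ge 0$ be integers and let $M=\#\{\alpha\in\mathbb{Z}_{\ge 0}^m : \sum_j\alpha_j=n\}$ be the number of states of $n$ photons in $m$ modes (so $M=\binom{m+n-1}{n}$ when $m\ge1$). Let $\varphi:U(m)\to U(M)$ be the photonic homomorphism, given in the basis of these states by $$\varphi(S)_{\alpha\beta}=\frac{\operatorname{per}(S[\alpha,\beta])}{\sqrt{\prod_j\alpha_j!\,\prod_j\beta_j!}},$$ where $S[\alpha,\beta]$ is the $n\times n$ matrix obtained from $S$ by repeating the $j$-th row $\alpha_j$ times and the $k$-th column $\beta_k$ times. Let $d\varphi:\mathfrak{u}(m)\to\mathfrak{u}(M)$ be its differential at the identity. Equip $\mathfrak{u}(M)$ with the inner product $\langle u,v\rangle=\frac12\operatorname{tr}(u^\dagger v+v^\dagger u)$ and, for $v\in\mathfrak{u}(M)$, let $v_T$ be the orthogonal projection of $v$ onto $\operatorname{im} d\varphi$. Let $d$ be the Riemannian distance on $U(M)$ of the bi-invariant metric which extends this inner product, i.e. $d(p,q)$ is the infimum of the lengths of the piecewise differentiable curves in $U(M)$ joining $p$ and $q$. For $V\in U(M)$ let $\log V$ denote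 its principal logarithm, i.e. $\log V=iK$ with $K$ Hermitian, $\exp(iK)=V$ and all eigenvalues of $K$ in $(-\pi,\pi]$. Let $U\in U(M)$ and define $U_0=\mathrm{Id}$ and $U_{i+1}=U_i\exp\big((\log(U_i^{-1}U))_T\big)$ for $i\ge0$. Then for every $i\ge 0$ $$d(U_{i+1},U)\le d(U_i,U),$$ and equality holds if and only if $U_{i+1}=U_i$. -/

import Mathlib

namespace LinearOptics

open scoped Matrix Nat

/-! ### Fock basis and the photonic homomorphism -/

/-- The modes occupied by the `n` photons of a Fock state, listed in increasing order.  A Fock state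
of `n` photons in `m` modes is a multiset of `n` modes, that is, an element of `Sym (Fin m) n`. -/
def modeList {m n : ℕ} (α : Sym (Fin m) n) : Fin n → Fin m := fun i =>
  ((α : Multiset (Fin m)).sort (· ≤ ·)).get
    (i.cast (by rw [Multiset.length_sort]; exact α.2.symm))

/-- `∏ⱼ αⱼ!`, where `αⱼ` is the number of photons of `α` in the mode `j`. -/
def occFactorial {m n : ℕ} (α : Sym (Fin m) n) : ℕ :=
  ∏ j : Fin m, ((α : Multiset (Fin m)).count j)!

/-- The evolution matrix in the Fock basis: `⟨α|φ(S)|β⟩ = per S[α,β] / √(∏ⱼ αⱼ! ∏ⱼ βⱼ!)`, where row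
`j` of `S` is repeated `αⱼ` times and column `k` is repeated `βₖ` times. -/
noncomputable def photonicMatrix {m : ℕ} (n : ℕ) (S : Matrix (Fin m) (Fin m) ℂ) :
    Matrix (Sym (Fin m) n) (Sym (Fin m) n) ℂ :=
  Matrix.of fun α β => (S.submatrix (modeList α) (modeList β)).permanent /
    (Real.sqrt (occFactorial α * occFactorial β) : ℂ)

/-- the Fock state of a list of modes -/
def fockOf {m n : ℕ} (g : Fin n → Fin m) : Sym (Fin m) n :=
  ⟨Finset.univ.val.map g, by simp⟩

lemma fockOf_modeList {m n : ℕ} (α : Sym (Fin m) n) : fockOf (modeList α) = α := by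
  apply Subtype.ext
  have h : ((α : Multiset (Fin m)).sort (· ≤ ·)).length = n := by
    rw [Multiset.length_sort]; exact α.2
  have h2 : List.ofFn (modeList α) = (α : Multiset (Fin m)).sort (· ≤ ·) := by
    apply List.ext_get
    · simp [h]
    · intro i h1 h2
      simp [modeList]
  show Finset.univ.val.map (modeList α) = _
  rw [Fin.univ_val_map, h2, Multiset.sort_eq]
  rfl

lemma count_fockOf {m n : ℕ} (g : Fin n → Fin m) (j : Fin m) :
    ((fockOf g : Sym (Fin m) n) : Multiset (Fin m)).count j = Fintype.card {a // g a = j} := by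
  show (Finset.univ.val.map g).count j = _
  rw [Multiset.count_map, Fintype.card_subtype]
  simp [Finset.card, eq_comm]

lemma exists_perm {m n : ℕ} {f g : Fin n → Fin m} (h : fockOf f = fockOf g) :
    ∃ σ : Equiv.Perm (Fin n), f ∘ σ = g := by
  have hc : ∀ j, Nonempty ({a // g a = j} ≃ {a // f a = j}) := fun j =>
    Fintype.card_eq.mp (by rw [← count_fockOf, ← count_fockOf, h])
  let e : ∀ j, {a // g a = j} ≃ {a // f a = j} := fun j => (hc j).some
  refine ⟨(Equiv.sigmaFiberEquiv g).symm.trans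
    ((Equiv.sigmaCongrRight e).trans (Equiv.sigmaFiberEquiv f)), ?_⟩
  funext a
  exact (e (g a) ⟨a, rfl⟩).2

lemma fockOf_comp {m n : ℕ} (f : Fin n → Fin m) (σ : Equiv.Perm (Fin n)) :
    fockOf (f ∘ σ) = fockOf f := by
  apply Subtype.ext
  show Finset.univ.val.map (f ∘ σ) = Finset.univ.val.map f
  rw [← Multiset.map_map, Multiset.map_univ_val_equiv]

lemma card_perm_eq {m n : ℕ} (f g : Fin n → Fin m) :
    (Finset.univ.filter fun σ : Equiv.Perm (Fin n) => f ∘ σ = g).card =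
      if fockOf g = fockOf f then occFactorial (fockOf f) else 0 := by
  split_ifs with h
  · obtain ⟨τ, rfl⟩ := exists_perm h.symm
    rw [← Fintype.card_subtype]
    simp only [occFactorial, count_fockOf]
    rw [← DomMulAct.stabilizer_card f]
    refine Fintype.card_congr ((Equiv.mulRight τ⁻¹).subtypeEquiv fun σ => ?_)
    simp only [Equiv.coe_mulRight, Equiv.Perm.coe_mul]
    constructor
    · intro h1
      rw [← Function.comp_assoc, h1, Function.comp_assoc, ← Equiv.Perm.coe_mul]; simp
    · intro h1
      conv_rhs => rw [← h1]
      rw [Function.comp_assoc, Function.comp_assoc, ← Equiv.Perm.coe_mul]; simp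
  · rw [Finset.card_eq_zero, Finset.filter_eq_empty_iff]
    rintro σ - rfl
    exact h (fockOf_comp f σ)

lemma sum_perm_eq {m n : ℕ} (f : Fin n → Fin m) (H : (Fin n → Fin m) → ℂ) :
    ∑ σ : Equiv.Perm (Fin n), H (f ∘ σ) =
      occFactorial (fockOf f) * ∑ g with fockOf g = fockOf f, H g := by
  rw [← Finset.sum_fiberwise (s := Finset.univ) (g := fun σ : Equiv.Perm (Fin n) => f ∘ σ),
    Finset.mul_sum, Finset.sum_filter]
  refine Finset.sum_congr rfl fun g _ => ?_
  rw [Finset.sum_congr rfl (g := fun _ => H g) (by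
    intro σ hσ; rw [(Finset.mem_filter.mp hσ).2])]
  rw [Finset.sum_const, card_perm_eq]
  split_ifs <;> simp

lemma occFactorial_pos {m n : ℕ} (α : Sym (Fin m) n) : 0 < occFactorial α :=
  Finset.prod_pos fun _ _ => Nat.factorial_pos _

lemma sum_eq_sum_fock {m n : ℕ} (H : (Fin n → Fin m) → ℂ) :
    ∑ g, H g = ∑ β : Sym (Fin m) n,
      (∑ σ : Equiv.Perm (Fin n), H (modeList β ∘ σ)) / occFactorial β := by
  rw [← Finset.sum_fiberwise (s := Finset.univ) (g := fockOf)]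
  refine Finset.sum_congr rfl fun β _ => ?_
  rw [sum_perm_eq, fockOf_modeList, mul_div_cancel_left₀]
  exact_mod_cast (occFactorial_pos β).ne'

lemma permanent_mul_submatrix {m n : ℕ} (S T : Matrix (Fin m) (Fin m) ℂ) (f h : Fin n → Fin m) :
    ((S * T).submatrix f h).permanent = ∑ β : Sym (Fin m) n,
      (S.submatrix f (modeList β)).permanent * (T.submatrix (modeList β) h).permanent /
        occFactorial β := by
  have h1 : ((S * T).submatrix f h).permanent =
      ∑ g : Fin n → Fin m, (S.submatrix f g).permanent * ∏ i, T (g i) (h i) := by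
    simp only [Matrix.permanent, Matrix.submatrix_apply, Matrix.mul_apply, Finset.prod_univ_sum,
      Fintype.piFinset_univ, Finset.sum_mul, Finset.prod_mul_distrib]
    rw [Finset.sum_comm]
  rw [h1, sum_eq_sum_fock]
  refine Finset.sum_congr rfl fun β _ => ?_
  congr 1
  rw [Matrix.permanent, Matrix.permanent, Finset.mul_sum]
  refine Finset.sum_congr rfl fun σ _ => ?_
  congr 1
  have := Matrix.permanent_permute_rows σ (S.submatrix f (modeList β))
  have := Matrix.permanent_permute_cols σ (S.submatrix f (modeList β))
  simp only [Matrix.submatrix_submatrix, Function.comp_id] at *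
  assumption

lemma photonicMatrix_mul {m n : ℕ} (S T : Matrix (Fin m) (Fin m) ℂ) :
    photonicMatrix n (S * T) = photonicMatrix n S * photonicMatrix n T := by
  ext α γ
  simp only [photonicMatrix, Matrix.mul_apply, Matrix.of_apply, permanent_mul_submatrix,
    Finset.sum_div]
  refine Finset.sum_congr rfl fun β _ => ?_
  have hβ : (Real.sqrt (occFactorial β) : ℂ) * (Real.sqrt (occFactorial β) : ℂ) =
      occFactorial β := by
    rw [← Complex.ofReal_mul, Real.mul_self_sqrt (by positivity)]; simp
  rw [Real.sqrt_mul (by positivity), Real.sqrt_mul (by positivity),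
    Real.sqrt_mul (by positivity), ← hβ]
  push_cast
  simp only [div_eq_mul_inv, mul_inv]
  ring

lemma photonicMatrix_one {m n : ℕ} :
    photonicMatrix n (1 : Matrix (Fin m) (Fin m) ℂ) = 1 := by
  ext α β
  have h1 : ((1 : Matrix (Fin m) (Fin m) ℂ).submatrix (modeList α) (modeList β)).permanent =
      if α = β then (occFactorial α : ℂ) else 0 := by
    have : ∀ σ : Equiv.Perm (Fin n), ∏ i, (1 : Matrix (Fin m) (Fin m) ℂ).submatrix (modeList α)
        (modeList β) (σ i) i = if modeList α ∘ σ = modeList β then 1 else 0 := by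
      intro σ
      simp only [Matrix.submatrix_apply, Matrix.one_apply, Finset.prod_ite_zero, funext_iff]
      simp
    rw [Matrix.permanent, Finset.sum_congr rfl fun σ _ => this σ, Finset.sum_boole, card_perm_eq,
      fockOf_modeList, fockOf_modeList]
    simp only [eq_comm (a := β)]
    split_ifs <;> simp
  rw [photonicMatrix, Matrix.of_apply, h1, Matrix.one_apply]
  split_ifs with h
  · subst h
    rw [Real.sqrt_mul_self (by positivity)]
    simp [(occFactorial_pos α).ne']
  · simp

lemma photonicMatrix_conjTranspose {m n : ℕ} (S : Matrix (Fin m) (Fin m) ℂ) :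
    photonicMatrix n Sᴴ = (photonicMatrix n S)ᴴ := by
  ext α β
  rw [Matrix.conjTranspose_apply]
  simp only [photonicMatrix, Matrix.of_apply]
  rw [← Matrix.permanent_transpose]
  simp [Matrix.permanent, mul_comm]

/-- The photonic homomorphism `φ : U(m) → U(M)`. -/
noncomputable def photonicHom (m n : ℕ) :
    Matrix.unitaryGroup (Fin m) ℂ →* Matrix.unitaryGroup (Sym (Fin m) n) ℂ where
  toFun S := ⟨photonicMatrix n (S : Matrix (Fin m) (Fin m) ℂ), by
    rw [Matrix.mem_unitaryGroup_iff, Matrix.star_eq_conjTranspose, ← photonicMatrix_conjTranspose,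
      ← photonicMatrix_mul, ← Matrix.star_eq_conjTranspose, Matrix.mem_unitaryGroup_iff.mp S.2,
      photonicMatrix_one]⟩
  map_one' := Subtype.ext photonicMatrix_one
  map_mul' S T := Subtype.ext (photonicMatrix_mul _ _)

/-! ### Lie algebras, the differential of the photonic homomorphism, the tangent projection -/

/-- The Lie algebra of the unitary group: the real vector space of skew-Hermitian matrices. -/
noncomputable abbrev lieU (N : Type*) [Fintype N] [DecidableEq N] : Submodule ℝ (Matrix N N ℂ) :=
  skewAdjoint.submodule ℝ (Matrix N N ℂ)

section Differential

lemma differentiable_photonicMatrix {m n : ℕ} :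
    Differentiable ℝ (photonicMatrix n : Matrix (Fin m) (Fin m) ℂ → _) := by
  open scoped Matrix.Norms.Elementwise in
  have h0 : ∀ i j, Differentiable ℝ fun S : Matrix (Fin m) (Fin m) ℂ => S i j := fun i j =>
    (differentiable_apply (𝕜 := ℝ) j (F' := fun _ : Fin m => ℂ)).comp
      (differentiable_apply (𝕜 := ℝ) i (F' := fun _ : Fin m => Fin m → ℂ))
  open scoped Matrix.Norms.Elementwise in
  refine differentiable_pi.2 fun α => differentiable_pi.2 fun β => ?_
  simp only [photonicMatrix, Matrix.of_apply, Matrix.permanent, Matrix.submatrix_apply,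
    div_eq_mul_inv]
  fun_prop

open scoped Matrix.Norms.Frobenius in
lemma mem_lieU_of_hasDerivAt {N : Type*} [Fintype N] [DecidableEq N] {γ : ℝ → Matrix N N ℂ}
    {v : Matrix N N ℂ} (hγ : ∀ t, γ t ∈ Matrix.unitaryGroup N ℂ) (h0 : γ 0 = 1)
    (hv : HasDerivAt γ v 0) : v ∈ lieU N := by
  have h1 := hv.mul hv.star
  have h2 : (γ * fun x => star (γ x)) = fun _ => 1 := by
    funext t; exact Matrix.mem_unitaryGroup_iff.mp (hγ t)
  rw [h2] at h1
  have h3 := h1.unique (hasDerivAt_const 0 1)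
  rw [h0, star_one, mul_one, one_mul] at h3
  show v ∈ skewAdjoint _
  rw [skewAdjoint.mem_iff]
  exact (neg_eq_of_add_eq_zero_right h3).symm

open scoped Matrix.Norms.Frobenius in
lemma exp_mem_unitaryGroup {N : Type*} [Fintype N] [DecidableEq N] {v : Matrix N N ℂ}
    (hv : v ∈ lieU N) : NormedSpace.exp v ∈ Matrix.unitaryGroup N ℂ :=
  NormedSpace.exp_mem_unitary_of_mem_skewAdjoint hv

open scoped Matrix.Norms.Frobenius in
/-- The derivative at `1` of the polynomial map `photonicMatrix` is the velocity of the images under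
`φ` of the one-parameter groups of `U(m)`. -/
lemma hasDerivAt_photonicMatrix_exp {m : ℕ} (n : ℕ) (h : Matrix (Fin m) (Fin m) ℂ) :
    HasDerivAt (fun t : ℝ => photonicMatrix n (NormedSpace.exp (t • h)))
      (fderiv ℝ (photonicMatrix n) 1 h) 0 := by
  have h1 : HasDerivAt (fun t : ℝ => NormedSpace.exp (t • h)) h 0 := by
    have h2 := hasDerivAt_exp_smul_const (𝕂 := ℝ) h (0 : ℝ)
    rw [zero_smul, NormedSpace.exp_zero, one_mul] at h2
    exact h2
  have h2 : HasFDerivAt (photonicMatrix n : Matrix (Fin m) (Fin m) ℂ → _)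
      (fderiv ℝ (photonicMatrix n) 1) (NormedSpace.exp ((0 : ℝ) • h)) := by
    rw [zero_smul, NormedSpace.exp_zero]
    exact (differentiable_photonicMatrix 1).hasFDerivAt
  exact h2.comp_hasDerivAt 0 h1

lemma fderiv_photonicMatrix_mem {m : ℕ} (n : ℕ) (h : lieU (Fin m)) :
    fderiv ℝ (photonicMatrix n) 1 (h : Matrix (Fin m) (Fin m) ℂ) ∈ lieU (Sym (Fin m) n) := by
  refine mem_lieU_of_hasDerivAt (fun t => ?_) ?_ (hasDerivAt_photonicMatrix_exp n h.1)
  · exact (photonicHom m n ⟨_, exp_mem_unitaryGroup ((lieU (Fin m)).smul_mem t h.2)⟩).2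
  · rw [zero_smul, NormedSpace.exp_zero, photonicMatrix_one]

/-- The differential `dφ : 𝔲(m) → 𝔲(M)` of the photonic homomorphism at the identity. -/
noncomputable def photonicDifferential (m n : ℕ) :
    lieU (Fin m) →ₗ[ℝ] lieU (Sym (Fin m) n) :=
  LinearMap.codRestrict (lieU (Sym (Fin m) n))
    ((fderiv ℝ (photonicMatrix n) (1 : Matrix (Fin m) (Fin m) ℂ)).toLinearMap ∘ₗ
      (lieU (Fin m)).subtype)
    (fderiv_photonicMatrix_mem n)

/-- The image algebra `im dφ`, as a real subspace of `𝔲(M)`. -/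
noncomputable def imageAlgebra (m n : ℕ) : Submodule ℝ (lieU (Sym (Fin m) n)) :=
  LinearMap.range (photonicDifferential m n)

end Differential

section Metric

variable {N : Type*} [Fintype N]

/-- `⟨A, B⟩ = ½ tr (A† B + B† A)`, a real bilinear form on complex matrices (the trace is real). -/
noncomputable def metricForm (N : Type*) [Fintype N] : LinearMap.BilinForm ℝ (Matrix N N ℂ) :=
  LinearMap.mk₂ ℝ (fun A B => (1 / 2 : ℝ) * (Matrix.trace (Aᴴ * B + Bᴴ * A)).re)
    (fun A A' B => by
      simp only [Matrix.conjTranspose_add, add_mul, mul_add, Matrix.trace_add, Complex.add_re]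
      ring)
    (fun c A B => by
      simp only [Matrix.conjTranspose_smul, Matrix.smul_mul, Matrix.mul_smul, star_trivial,
        Matrix.trace_add, Matrix.trace_smul, Complex.add_re, Complex.smul_re, smul_eq_mul]
      ring)
    (fun A B B' => by
      simp only [Matrix.conjTranspose_add, add_mul, mul_add, Matrix.trace_add, Complex.add_re]
      ring)
    (fun c A B => by
      simp only [Matrix.conjTranspose_smul, Matrix.smul_mul, Matrix.mul_smul, star_trivial,
        Matrix.trace_add, Matrix.trace_smul, Complex.add_re, Complex.smul_re, smul_eq_mul]
      ring)

lemma metricForm_apply (A B : Matrix N N ℂ) :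
    metricForm N A B = (1 / 2 : ℝ) * (Matrix.trace (Aᴴ * B + Bᴴ * A)).re := rfl

lemma metricForm_comm (A B : Matrix N N ℂ) : metricForm N A B = metricForm N B A := by
  rw [metricForm_apply, metricForm_apply, add_comm]

lemma metricForm_self (A : Matrix N N ℂ) : metricForm N A A = ∑ i, ∑ j, ‖A i j‖ ^ 2 := by
  rw [metricForm_apply, Matrix.trace_add, Complex.add_re, ← two_mul, ← mul_assoc]
  norm_num
  rw [Matrix.trace, Complex.re_sum, Finset.sum_comm]
  refine Finset.sum_congr rfl fun j _ => ?_
  rw [Matrix.diag_apply, Matrix.mul_apply, Complex.re_sum]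
  refine Finset.sum_congr rfl fun i _ => ?_
  rw [Matrix.conjTranspose_apply, ← Complex.normSq_eq_norm_sq, Complex.star_def,
    ← Complex.normSq_eq_conj_mul_self, Complex.ofReal_re]

lemma eq_zero_of_metricForm_self {A : Matrix N N ℂ} (h : metricForm N A A = 0) : A = 0 := by
  rw [metricForm_self, Finset.sum_eq_zero_iff_of_nonneg (fun _ _ => by positivity)] at h
  ext i j
  have := h i (Finset.mem_univ i)
  rw [Finset.sum_eq_zero_iff_of_nonneg (fun _ _ => by positivity)] at this
  simpa using this j (Finset.mem_univ j)

variable [DecidableEq N]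

/-- The form is invariant under left and right translations by unitary matrices, so its restriction
to the tangent spaces of the unitary group is the bi-invariant metric that extends its values on the
Lie algebra. -/
lemma metricForm_unitary (P Q : Matrix.unitaryGroup N ℂ) (A B : Matrix N N ℂ) :
    metricForm N ((P : Matrix N N ℂ) * A * Q) ((P : Matrix N N ℂ) * B * Q) = metricForm N A B := by
  have hP : (P : Matrix N N ℂ)ᴴ * P = 1 := Matrix.mem_unitaryGroup_iff'.mp P.2
  have hQ : (Q : Matrix N N ℂ) * (Q : Matrix N N ℂ)ᴴ = 1 := Matrix.mem_unitaryGroup_iff.mp Q.2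
  have key : ∀ X Y : Matrix N N ℂ,
      Matrix.trace (((P : Matrix N N ℂ) * X * (Q : Matrix N N ℂ))ᴴ *
        ((P : Matrix N N ℂ) * Y * (Q : Matrix N N ℂ))) = Matrix.trace (Xᴴ * Y) := by
    intro X Y
    calc _ = Matrix.trace ((Q : Matrix N N ℂ)ᴴ *
          (Xᴴ * ((P : Matrix N N ℂ)ᴴ * (P : Matrix N N ℂ)) * Y * (Q : Matrix N N ℂ))) := by
          simp only [Matrix.conjTranspose_mul, Matrix.mul_assoc]
      _ = _ := by
          rw [Matrix.trace_mul_comm, hP, Matrix.mul_one, Matrix.mul_assoc, hQ, Matrix.mul_one]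
  rw [metricForm_apply, metricForm_apply, Matrix.trace_add, key, key, Matrix.trace_add]

/-- The inner product `⟨u, v⟩ = ½ tr (u† v + v† u)` on the Lie algebra. -/
noncomputable def lieInner (N : Type*) [Fintype N] [DecidableEq N] :
    LinearMap.BilinForm ℝ (lieU N) :=
  (metricForm N).restrict (lieU N)

/-- The decomposition `𝔲(M) = W ⊕ W^⊥`. -/
lemma isCompl_orthogonal (W : Submodule ℝ (lieU N)) :
    IsCompl W ((lieInner N).orthogonal W) := by
  have hrefl : (lieInner N).IsRefl := by
    intro x y h
    rw [← h]
    exact metricForm_comm _ _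
  rw [LinearMap.BilinForm.isCompl_orthogonal_iff_disjoint hrefl, Submodule.disjoint_def]
  intro x hx hx'
  exact Subtype.ext (eq_zero_of_metricForm_self (hx' x hx))

/-- The tangent component `v_T ∈ im dφ` in the orthogonal decomposition `v = v_T + v_N` of
`𝔲(M) = im dφ ⊕ (im dφ)^⊥`. -/
noncomputable def tangentPart (m n : ℕ) : lieU (Sym (Fin m) n) →ₗ[ℝ] lieU (Sym (Fin m) n) :=
  (imageAlgebra m n).projection _ (isCompl_orthogonal (imageAlgebra m n))

end Metric

/-! ### The Riemannian distance, the principal logarithm and the iteration -/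

section Distance

variable {N : Type*} [Fintype N] [DecidableEq N]

open scoped Matrix.Norms.Frobenius in
/-- `γ` restricted to `[0, 1]` is a continuous, piecewise continuously differentiable curve in the
unitary group from `p` to `q`. -/
structure IsCurveJoining (p q : Matrix.unitaryGroup N ℂ) (γ : ℝ → Matrix N N ℂ) : Prop where
  source : γ 0 = p
  target : γ 1 = q
  mem_unitaryGroup : ∀ t ∈ Set.Icc (0 : ℝ) 1, γ t ∈ Matrix.unitaryGroup N ℂ
  continuousOn : ContinuousOn γ (Set.Icc 0 1)
  piecewise_contDiffOn : ∃ (k : ℕ) (τ : ℕ → ℝ), τ 0 = 0 ∧ τ k = 1 ∧ (∀ i < k, τ i < τ (i + 1)) ∧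
    ∀ i < k, ContDiffOn ℝ 1 γ (Set.Icc (τ i) (τ (i + 1)))

/-- The length of a curve on `[0, 1]`: the integral of its speed in the bi-invariant metric. -/
noncomputable def curveLength (γ : ℝ → Matrix N N ℂ) : ℝ :=
  ∫ t in (0 : ℝ)..1, Real.sqrt (metricForm N (deriv γ t) (deriv γ t))

/-- The Riemannian distance on the unitary group: the infimum of the lengths of the piecewise
continuously differentiable curves between two points. -/
noncomputable def riemannianDist (p q : Matrix.unitaryGroup N ℂ) : ℝ :=
  sInf {l : ℝ | ∃ γ : ℝ → Matrix N N ℂ, IsCurveJoining p q γ ∧ l = curveLength γ}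

/-- `v` is a principal logarithm of `V`: `v = iK` and `exp (iK) = V` for a Hermitian matrix `K` with
all its eigenvalues in `(-π, π]`. -/
def IsPrincipalLog (V v : Matrix N N ℂ) : Prop :=
  ∃ K : Matrix N N ℂ, K.IsHermitian ∧ spectrum ℝ K ⊆ Set.Ioc (-Real.pi) Real.pi ∧
    NormedSpace.exp (Complex.I • K) = V ∧ v = Complex.I • K

lemma IsPrincipalLog.mem_lieU {V v : Matrix N N ℂ} (h : IsPrincipalLog V v) : v ∈ lieU N := by
  obtain ⟨K, hK, -, -, rfl⟩ := h
  exact IsSelfAdjoint.smul_mem_skewAdjoint Complex.conj_I hK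

lemma IsPrincipalLog.exp_eq {V v : Matrix N N ℂ} (h : IsPrincipalLog V v) :
    NormedSpace.exp v = V := by
  obtain ⟨K, -, -, hV, rfl⟩ := h
  exact hV

open scoped Matrix.Norms.L2Operator in
lemma exists_isPrincipalLog (V : Matrix.unitaryGroup N ℂ) :
    ∃ v : lieU N, IsPrincipalLog (V : Matrix N N ℂ) v := by
  suffices h : ∃ v, IsPrincipalLog (V : Matrix N N ℂ) v by
    obtain ⟨v, hv⟩ := h
    exact ⟨⟨v, hv.mem_lieU⟩, hv⟩
  have hfin : (spectrum ℂ (V : Matrix N N ℂ)).Finite := Matrix.finite_spectrum _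
  have hVu : (V : Matrix N N ℂ) ∈ unitary (Matrix N N ℂ) := V.2
  have hVn : IsStarNormal (V : Matrix N N ℂ) := ⟨by
    rw [commute_iff_eq, (Unitary.mem_iff.mp hVu).1, (Unitary.mem_iff.mp hVu).2]⟩
  have hc : ContinuousOn (fun z : ℂ => (Complex.arg z : ℂ)) (spectrum ℂ (V : Matrix N N ℂ)) :=
    hfin.continuousOn _
  have hsa : IsSelfAdjoint (cfc (fun z : ℂ => (Complex.arg z : ℂ)) (V : Matrix N N ℂ)) :=
    IsSelfAdjoint.cfc_arg _
  refine ⟨_, cfc (fun z : ℂ => (Complex.arg z : ℂ)) (V : Matrix N N ℂ), hsa, ?_, ?_, rfl⟩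
  · intro r hr
    have h1 : (r : ℂ) ∈ spectrum ℂ (cfc (fun z : ℂ => (Complex.arg z : ℂ)) (V : Matrix N N ℂ)) :=
      spectrum.algebraMap_mem ℂ hr
    rw [cfc_map_spectrum ..] at h1
    obtain ⟨z, -, hz⟩ := h1
    rw [← Complex.ofReal_injective hz]
    exact Complex.arg_mem_Ioc z
  · rw [← CFC.exp_eq_normedSpace_exp (𝕜 := ℂ), ← cfc_comp_smul .., ← cfc_comp' ..]
    conv_rhs => rw [← cfc_id' ℂ (V : Matrix N N ℂ)]
    refine cfc_congr fun y hy => ?_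
    have hy₁ : ‖y‖ = 1 := spectrum.norm_eq_one_of_unitary hVu hy
    have : Complex.I * y.arg = Complex.log y :=
      Complex.ext (by simp [Complex.log_re, hy₁]) (by simp [Complex.log_im])
    have hy0 : y ≠ 0 := by rintro rfl; simp at hy₁
    simpa [← Complex.exp_eq_exp_ℂ, this] using Complex.exp_log hy0

/-- The principal logarithm of a unitary matrix, as an element of the Lie algebra. -/
noncomputable def principalLog (V : Matrix.unitaryGroup N ℂ) : lieU N :=
  (exists_isPrincipalLog V).choose

lemma isPrincipalLog_principalLog (V : Matrix.unitaryGroup N ℂ) :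
    IsPrincipalLog (V : Matrix N N ℂ) (principalLog V) :=
  (exists_isPrincipalLog V).choose_spec

/-- The exponential map from the Lie algebra to the unitary group. -/
noncomputable def expU (v : lieU N) : Matrix.unitaryGroup N ℂ :=
  ⟨NormedSpace.exp (v : Matrix N N ℂ), exp_mem_unitaryGroup v.2⟩

lemma expU_principalLog (V : Matrix.unitaryGroup N ℂ) : expU (principalLog V) = V :=
  Subtype.ext (isPrincipalLog_principalLog V).exp_eq

open scoped Matrix.Norms.Frobenius in
/-- Any two unitary matrices are joined by a curve, so that the infimum in `riemannianDist` is over a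
nonempty set of nonnegative numbers. -/
lemma exists_isCurveJoining (p q : Matrix.unitaryGroup N ℂ) : ∃ γ, IsCurveJoining p q γ := by
  set v := principalLog (p⁻¹ * q) with hv
  have hd : ContDiff ℝ 1 fun t : ℝ => (p : Matrix N N ℂ) * NormedSpace.exp (t • (v : Matrix N N ℂ)) :=
    contDiff_const.mul ((show ContDiff ℝ 1 (NormedSpace.exp : Matrix N N ℂ → _) from
      contDiff_iff_contDiffAt.2 fun x => (NormedSpace.exp_analytic (𝕂 := ℝ) x).contDiffAt).comp (contDiff_id.smul contDiff_const))
  refine ⟨fun t => p * NormedSpace.exp (t • (v : Matrix N N ℂ)), by simp, ?_, fun t _ => ?_,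
    hd.continuous.continuousOn, 1, fun i => i, by simp, by simp, by simp, fun _ _ => hd.contDiffOn⟩
  · have := congrArg Subtype.val (congrArg (p * ·) (expU_principalLog (p⁻¹ * q)))
    simpa [expU, ← hv] using this
  · exact mul_mem p.2 (exp_mem_unitaryGroup ((lieU N).smul_mem t v.2))

end Distance

/-- The iteration `U₀ = Id`, `Uᵢ₊₁ = Uᵢ exp ((log (Uᵢ⁻¹ U))_T)` for the target `U`. -/
noncomputable def approxSeq (m n : ℕ) (U : Matrix.unitaryGroup (Sym (Fin m) n) ℂ) :
    ℕ → Matrix.unitaryGroup (Sym (Fin m) n) ℂ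
  | 0 => 1
  | i + 1 => approxSeq m n U i *
      expU (tangentPart m n (principalLog ((approxSeq m n U i)⁻¹ * U)))

end LinearOptics

/-! Write `p = Uᵢ`, `q = Uᵢ₊₁`, `v = log (p⁻¹ U)`, so that `U = p exp v` and `q = p exp v_T`. The
theorem is the chain `d(q, U) ≤ ‖v - v_T‖ ≤ ‖v‖ ≤ d(p, U)` in the Frobenius norm. The middle
inequality is Pythagoras (`norm_sq_sub_tangentPart`). Equality of the two ends forces `‖v_T‖ = 0`,
hence `q = p`. Of `v_T`, only orthogonality of the projection is used.

The left inequality (`riemannianDist_mul_expU_le`) holds because `exp` is 1-Lipschitz on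
skew-Hermitian matrices: it carries the segment from `v_T` to `v` to a curve from `q` to `U` that is
no longer than the segment.

The right inequality (`norm_principalLog_le_curveLength`) is the substantial one. Let `v = iK` with
orthonormal eigenvectors `eⱼ` and eigenvalues `θⱼ`. A curve `γ` from `p` to `U` moves `γ eⱼ` on the
unit sphere from `p eⱼ` to `exp(iθⱼ) p eⱼ`, and the real angle between these is `|θⱼ|` because `|θⱼ|
≤ π`. The angle from `p eⱼ` grows at rate at most `‖γ' eⱼ‖`. Weighting the angles by `|θⱼ|`,
Cauchy–Schwarz bounds the growth rate of the sum by `‖v‖ ‖γ'‖`; integration gives `‖v‖² ≤ ‖v‖ ·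
length γ`. -/

namespace LinearOptics

open scoped Matrix Matrix.Norms.Frobenius
open Set MeasureTheory

/-! ### Angles along curves on a unit sphere -/

section Sphere

variable {𝕜 E : Type*} [RCLike 𝕜] [NormedAddCommGroup E] [InnerProductSpace 𝕜 E] [NormedSpace ℝ E]

/-- The tangential projection of `e` at a point `c` of the unit sphere has norm `√(1 - u²)`, where
`u = re ⟪e, c⟫`; so `|u'| ≤ √(1 - u²) ‖c'‖` along a curve in the sphere. -/
lemma abs_re_inner_deriv_le {c : ℝ → E} {c' e : E} {t : ℝ} (he : ‖e‖ = 1)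
    (hc : ∀ᶠ s in nhds t, ‖c s‖ = 1) (hd : HasDerivAt c c' t) :
    |RCLike.re (inner 𝕜 e c')| ≤ √(1 - RCLike.re (inner 𝕜 e (c t)) ^ 2) * ‖c'‖ := by
  have hct : ‖c t‖ = 1 := hc.self_of_nhds
  -- Differentiate `⟪c, c⟫ = 1`.
  have horth : RCLike.re (inner 𝕜 (c t) c') = 0 := by
    have h1 := hd.inner 𝕜 hd
    have h2 : HasDerivAt (fun s => inner 𝕜 (c s) (c s)) (0 : 𝕜) t := by
      refine (hasDerivAt_const t (1 : 𝕜)).congr_of_eventuallyEq ?_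
      filter_upwards [hc] with s hs
      rw [inner_self_eq_norm_sq_to_K, hs]; simp
    have h3 := congrArg RCLike.re (h1.unique h2)
    rw [map_add, inner_re_symm (𝕜 := 𝕜) c' (c t), map_zero] at h3
    linarith
  set u : ℝ := RCLike.re (inner 𝕜 e (c t)) with hu
  have hn : ‖e - (u : 𝕜) • c t‖ = √(1 - u ^ 2) := by
    rw [← Real.sqrt_sq (norm_nonneg (e - (u : 𝕜) • c t)), norm_sub_sq (𝕜 := 𝕜), inner_smul_right,
      RCLike.re_ofReal_mul, ← hu, norm_smul, he, hct, RCLike.norm_ofReal, mul_one, sq_abs]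
    congr 1; ring
  have hi : RCLike.re (inner 𝕜 e c') = RCLike.re (inner 𝕜 (e - (u : 𝕜) • c t) c') := by
    rw [inner_sub_left, inner_smul_left, map_sub, RCLike.conj_ofReal, RCLike.re_ofReal_mul, horth]
    ring
  rw [hi, ← hn]
  exact (RCLike.abs_re_le_norm _).trans (norm_inner_le_norm _ _)

/-- The factor `r < 1` keeps the argument away from `±1`, where `arccos` is not differentiable; the
angle itself is recovered later as `r → 1`. -/
lemma exists_hasDerivAt_arccos_le {c : ℝ → E} {c' e : E} {t r : ℝ} (hr0 : 0 ≤ r) (hr1 : r < 1)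
    (he : ‖e‖ = 1) (hc : ∀ᶠ s in nhds t, ‖c s‖ = 1) (hd : HasDerivAt c c' t) :
    ∃ a, HasDerivAt (fun s => Real.arccos (r * RCLike.re (inner 𝕜 e (c s)))) a t ∧ a ≤ ‖c'‖ := by
  have hle := abs_re_inner_deriv_le (𝕜 := 𝕜) he hc hd
  set u : ℝ := RCLike.re (inner 𝕜 e (c t)) with hu
  have hu1 : |u| ≤ 1 := by
    have := (RCLike.abs_re_le_norm (inner 𝕜 e (c t))).trans (norm_inner_le_norm e (c t))
    rwa [he, hc.self_of_nhds, one_mul] at this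
  have hu2 : u ^ 2 ≤ 1 := by rw [← sq_abs]; nlinarith [abs_nonneg u]
  have hru : (r * u) ^ 2 < 1 := by rw [mul_pow]; nlinarith [sq_nonneg u]
  have hab : |r * u| < 1 := by rwa [sq_lt_one_iff_abs_lt_one] at hru
  have hdu : HasDerivAt (fun s => RCLike.re (inner 𝕜 e (c s))) (RCLike.re (inner 𝕜 e c')) t := by
    have h1 := (hasDerivAt_const t e).inner 𝕜 hd
    rw [inner_zero_left, add_zero] at h1
    exact (RCLike.reCLM (K := 𝕜)).hasFDerivAt.comp_hasDerivAt t h1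
  have h2 := (Real.hasDerivAt_arccos (x := r * u) (by linarith [(abs_lt.mp hab).1] |> ne_of_gt)
    (abs_lt.mp hab).2.ne).comp t (hdu.const_mul r)
  refine ⟨_, h2, ?_⟩
  have hs : 0 < √(1 - (r * u) ^ 2) := Real.sqrt_pos.mpr (by linarith)
  -- After squaring this is `r² ≤ 1`: the damped angle grows no faster than the true one.
  have hss : r * √(1 - u ^ 2) ≤ √(1 - (r * u) ^ 2) := by
    rw [← Real.sqrt_sq hr0, ← Real.sqrt_mul (sq_nonneg r), Real.sqrt_sq hr0]
    exact Real.sqrt_le_sqrt (by nlinarith)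
  calc -(1 / √(1 - (r * u) ^ 2)) * (r * RCLike.re (inner 𝕜 e c'))
      = (r * -RCLike.re (inner 𝕜 e c')) / √(1 - (r * u) ^ 2) := by ring
    _ ≤ ‖c'‖ := by
      rw [div_le_iff₀ hs]
      calc r * -RCLike.re (inner 𝕜 e c') ≤ r * (√(1 - u ^ 2) * ‖c'‖) :=
            mul_le_mul_of_nonneg_left ((neg_le_abs _).trans hle) hr0
        _ = (r * √(1 - u ^ 2)) * ‖c'‖ := by ring
        _ ≤ √(1 - (r * u) ^ 2) * ‖c'‖ := mul_le_mul_of_nonneg_right hss (norm_nonneg _)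
        _ = _ := mul_comm _ _

end Sphere

/-! ### The metric as the Frobenius norm, and lengths of curves -/

variable {N : Type*} [Fintype N]

lemma metricForm_self_eq_norm_sq (A : Matrix N N ℂ) : metricForm N A A = ‖A‖ ^ 2 := by
  rw [metricForm_self, Matrix.frobenius_norm_def, ← Real.sqrt_eq_rpow, Real.sq_sqrt (by positivity)]
  simp

lemma curveLength_eq (γ : ℝ → Matrix N N ℂ) : curveLength γ = ∫ t in (0 : ℝ)..1, ‖deriv γ t‖ := by
  simp only [curveLength, metricForm_self_eq_norm_sq, Real.sqrt_sq (norm_nonneg _)]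

lemma curveLength_nonneg (γ : ℝ → Matrix N N ℂ) : 0 ≤ curveLength γ := by
  rw [curveLength_eq]
  exact intervalIntegral.integral_nonneg zero_le_one fun _ _ => norm_nonneg _

/-- Evaluation of matrices at a vector of the Euclidean space. -/
noncomputable def evalCLM (b : EuclideanSpace ℂ N) : Matrix N N ℂ →L[ℝ] EuclideanSpace ℂ N :=
  LinearMap.toContinuousLinearMap
    { toFun := fun A => WithLp.toLp 2 (A *ᵥ b)
      map_add' := fun A B => by rw [Matrix.add_mulVec, WithLp.toLp_add]
      map_smul' := fun r A => by rw [Matrix.smul_mulVec, WithLp.toLp_smul]; rfl }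

lemma evalCLM_apply (b : EuclideanSpace ℂ N) (A : Matrix N N ℂ) :
    evalCLM b A = WithLp.toLp 2 (A *ᵥ b) := rfl

variable [DecidableEq N]

lemma norm_unitary_mul_mul (P Q : Matrix.unitaryGroup N ℂ) (A : Matrix N N ℂ) :
    ‖(P : Matrix N N ℂ) * A * Q‖ = ‖A‖ := by
  rw [← sq_eq_sq₀ (norm_nonneg _) (norm_nonneg _), ← metricForm_self_eq_norm_sq,
    metricForm_unitary, metricForm_self_eq_norm_sq]

/-- A function whose growth along a piecewise differentiable curve is controlled by the speed grows
by at most the length. -/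
lemma IsCurveJoining.sub_le_mul_curveLength {p q : Matrix.unitaryGroup N ℂ} {γ : ℝ → Matrix N N ℂ}
    (hγ : IsCurveJoining p q γ) {Φ : ℝ → ℝ} {C : ℝ} (hΦ : ContinuousOn Φ (Icc 0 1))
    (h : ∀ t ∈ Ioo (0 : ℝ) 1, DifferentiableAt ℝ γ t →
      ∃ a, HasDerivAt Φ a t ∧ a ≤ C * ‖deriv γ t‖) :
    Φ 1 - Φ 0 ≤ C * curveLength γ := by
  obtain ⟨k, τ, h0, hk, hlt, hC⟩ := hγ.piecewise_contDiffOn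
  have hmono : ∀ i j, i ≤ j → j ≤ k → τ i ≤ τ j := by
    intro i j hij
    induction j, hij using Nat.le_induction with
    | base => exact fun _ => le_rfl
    | succ j _ ih => exact fun hj => (ih (by omega)).trans (hlt j (by omega)).le
  have hsub : ∀ i < k, 0 ≤ τ i ∧ τ (i + 1) ≤ 1 := fun i hi =>
    ⟨h0 ▸ hmono 0 i (by omega) (by omega), hk ▸ hmono (i + 1) k (by omega) le_rfl⟩
  have hcd : ∀ i < k, ∀ t ∈ Ioo (τ i) (τ (i + 1)), DifferentiableAt ℝ γ t := fun i hi t ht =>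
    ((hC i hi).differentiableOn one_ne_zero t (Ioo_subset_Icc_self ht)).differentiableAt
      (Icc_mem_nhds ht.1 ht.2)
  have hint : ∀ i < k, IntegrableOn (fun t => ‖deriv γ t‖) (Icc (τ i) (τ (i + 1))) := by
    intro i hi
    have h1 : IntegrableOn (fun t => ‖derivWithin γ (Icc (τ i) (τ (i + 1))) t‖)
        (Icc (τ i) (τ (i + 1))) :=
      ((hC i hi).continuousOn_derivWithin (uniqueDiffOn_Icc (hlt i hi)) le_rfl).norm.integrableOn_Icc
    -- `deriv` and `derivWithin` may differ at the breakpoints, a null set.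
    rw [integrableOn_Icc_iff_integrableOn_Ioo] at h1 ⊢
    refine h1.congr_fun (fun t ht => ?_) measurableSet_Ioo
    exact congrArg norm (derivWithin_of_mem_nhds (f := γ) (Icc_mem_nhds ht.1 ht.2))
  have hpiece : ∀ i < k, Φ (τ (i + 1)) - Φ (τ i) ≤
      C * ∫ t in (τ i)..(τ (i + 1)), ‖deriv γ t‖ := by
    intro i hi
    have hex : ∀ t ∈ Ioo (τ i) (τ (i + 1)), HasDerivAt Φ (deriv Φ t) t ∧
        deriv Φ t ≤ C * ‖deriv γ t‖ := by
      intro t ht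
      obtain ⟨a, ha, hle⟩ := h t ⟨(hsub i hi).1.trans_lt ht.1, ht.2.trans_le (hsub i hi).2⟩
        (hcd i hi t ht)
      exact ⟨ha.deriv ▸ ha, ha.deriv ▸ hle⟩
    -- The derivative of `Φ` need not be integrable: an integrable upper bound for it suffices.
    rw [← intervalIntegral.integral_const_mul]
    exact intervalIntegral.sub_le_integral_of_hasDeriv_right_of_le (hlt i hi).le
      (hΦ.mono (Icc_subset_Icc (hsub i hi).1 (hsub i hi).2))
      (fun t ht => (hex t ht).1.hasDerivWithinAt) ((hint i hi).const_mul C)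
      (fun t ht => (hex t ht).2)
  have hsum := intervalIntegral.sum_integral_adjacent_intervals (a := τ) (n := k)
    (f := fun t => ‖deriv γ t‖) (μ := volume) fun i hi =>
      (intervalIntegrable_iff_integrableOn_Icc_of_le (hlt i hi).le).mpr (hint i hi)
  rw [h0, hk] at hsum
  rw [curveLength_eq, ← hsum, Finset.mul_sum, ← h0, ← hk, ← Finset.sum_range_sub (fun i => Φ (τ i))]
  exact Finset.sum_le_sum fun i hi => hpiece i (Finset.mem_range.mp hi)

/-! ### Upper bound for the distance -/

/-- The exponential map of the unitary group does not increase distances. -/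
lemma norm_exp_sub_exp_le {x y : Matrix N N ℂ} (hx : x ∈ lieU N) (hy : y ∈ lieU N) :
    ‖NormedSpace.exp x - NormedSpace.exp y‖ ≤ ‖x - y‖ := by
  -- This path runs from `exp y` to `exp x`, and its derivative is `x - y` between two unitary
  -- factors, hence of norm `‖x - y‖`.
  have hd : ∀ s : ℝ, HasDerivAt
      (fun s : ℝ => NormedSpace.exp (s • x) * NormedSpace.exp ((1 - s) • y))
      (NormedSpace.exp (s • x) * (x - y) * NormedSpace.exp ((1 - s) • y)) s := by
    intro s
    have h1 := hasDerivAt_exp_smul_const (𝕂 := ℝ) x s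
    have h2 := (hasDerivAt_exp_smul_const' (𝕂 := ℝ) y (1 - s)).scomp s
      ((hasDerivAt_id s).const_sub 1)
    refine (h1.mul h2).congr_deriv ?_
    simp only [neg_smul, one_smul, Function.comp_apply]
    noncomm_ring
  have h := norm_image_sub_le_of_norm_deriv_le_segment_01'
    (fun s _ => (hd s).hasDerivWithinAt) (C := ‖x - y‖) fun s _ =>
      (norm_unitary_mul_mul ⟨_, exp_mem_unitaryGroup ((lieU N).smul_mem s hx)⟩
        ⟨_, exp_mem_unitaryGroup ((lieU N).smul_mem (1 - s) hy)⟩ (x - y)).le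
  simpa using h

/-- The competing curve is the image of the segment from `a` to `b`. Its speed is bounded through
the Lipschitz estimate, which avoids a formula for the differential of `exp`. -/
lemma riemannianDist_mul_expU_le (p : Matrix.unitaryGroup N ℂ) (a b : lieU N) :
    riemannianDist (p * expU a) (p * expU b) ≤ ‖(b : Matrix N N ℂ) - a‖ := by
  set γ : ℝ → Matrix N N ℂ := fun t =>
    p * NormedSpace.exp ((a + t • (b - a) : lieU N) : Matrix N N ℂ) with hγ
  have hd : ContDiff ℝ 1 γ :=
    contDiff_const.mul ((show ContDiff ℝ 1 (NormedSpace.exp : Matrix N N ℂ → _) from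
      contDiff_iff_contDiffAt.2 fun x =>
        (NormedSpace.exp_analytic (𝕂 := ℝ) x).contDiffAt).comp
          (contDiff_const.add (contDiff_id.smul contDiff_const)))
  have hj : IsCurveJoining (p * expU a) (p * expU b) γ :=
    ⟨by simp [hγ, expU], by simp [hγ, expU],
      fun t _ => mul_mem p.2 (exp_mem_unitaryGroup (SetLike.coe_mem _)),
      hd.continuous.continuousOn, 1, fun i => i, by simp, by simp, by simp,
      fun _ _ => hd.contDiffOn⟩
  have hle : riemannianDist (p * expU a) (p * expU b) ≤ curveLength γ := by
    refine csInf_le ⟨0, ?_⟩ ⟨γ, hj, rfl⟩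
    rintro _ ⟨γ, -, rfl⟩
    exact curveLength_nonneg γ
  have hlip : ∀ t, ‖deriv γ t‖ ≤ ‖(b : Matrix N N ℂ) - a‖ := by
    intro t
    refine norm_deriv_le_of_lip' (norm_nonneg _) (Filter.Eventually.of_forall fun s => ?_)
    rw [hγ]
    have h1 := norm_unitary_mul_mul p 1
      (NormedSpace.exp ((a + s • (b - a) : lieU N) : Matrix N N ℂ) -
        NormedSpace.exp ((a + t • (b - a) : lieU N) : Matrix N N ℂ))
    rw [OneMemClass.coe_one, mul_one, mul_sub] at h1
    rw [h1]
    refine (norm_exp_sub_exp_le (SetLike.coe_mem _) (SetLike.coe_mem _)).trans_eq ?_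
    have : ((a + s • (b - a) : lieU N) : Matrix N N ℂ) - ((a + t • (b - a) : lieU N) : Matrix N N ℂ)
        = (s - t) • ((b : Matrix N N ℂ) - a) := by
      push_cast
      module
    rw [this, norm_smul, mul_comm]
  rw [curveLength_eq] at hle
  have := intervalIntegral.norm_integral_le_of_norm_le_const (a := (0:ℝ)) (b := 1)
    (f := fun t => ‖deriv γ t‖) (C := ‖(b : Matrix N N ℂ) - a‖) fun t _ => by
      rw [norm_norm]; exact hlip t
  simpa using hle.trans ((le_abs_self _).trans this)

/-! ### Lower bound for the distance: eigenangles -/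

lemma norm_evalCLM_unitary (b : EuclideanSpace ℂ N) {A : Matrix N N ℂ}
    (hA : A ∈ Matrix.unitaryGroup N ℂ) : ‖evalCLM b A‖ = ‖b‖ := by
  have h : inner ℂ (evalCLM b A) (evalCLM b A) = inner ℂ b b := by
    rw [EuclideanSpace.inner_eq_star_dotProduct, EuclideanSpace.inner_eq_star_dotProduct,
      evalCLM_apply, dotProduct_comm, Matrix.star_mulVec, ← Matrix.dotProduct_mulVec,
      Matrix.mulVec_mulVec, ← Matrix.star_eq_conjTranspose, Matrix.mem_unitaryGroup_iff'.mp hA,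
      Matrix.one_mulVec, dotProduct_comm]
  rw [inner_self_eq_norm_sq_to_K, inner_self_eq_norm_sq_to_K] at h
  exact (sq_eq_sq₀ (norm_nonneg _) (norm_nonneg _)).mp (by exact_mod_cast h)

/-- The square of the Hilbert–Schmidt norm, computed in an orthonormal basis of eigenvectors. -/
lemma sum_norm_sq_evalCLM {K : Matrix N N ℂ} (hK : K.IsHermitian) (A : Matrix N N ℂ) :
    ∑ j, ‖evalCLM (hK.eigenvectorBasis j) A‖ ^ 2 = ‖A‖ ^ 2 := by
  -- The columns of `A` times the eigenvector matrix are the images of the eigenvectors under `A`.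
  have h := norm_unitary_mul_mul 1 hK.eigenvectorUnitary A
  rw [OneMemClass.coe_one, one_mul] at h
  rw [← h, ← metricForm_self_eq_norm_sq, metricForm_self, Finset.sum_comm]
  refine Finset.sum_congr rfl fun j _ => ?_
  rw [EuclideanSpace.norm_sq_eq]
  rfl

lemma evalCLM_exp_eigenvectorBasis {K : Matrix N N ℂ} (hK : K.IsHermitian) (j : N) :
    evalCLM (hK.eigenvectorBasis j) (NormedSpace.exp (Complex.I • K)) =
      Complex.exp (hK.eigenvalues j * Complex.I) • hK.eigenvectorBasis j := by
  set E := hK.eigenvectorUnitary with hE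
  have hu : IsUnit (E : Matrix N N ℂ) := ⟨Unitary.toUnits E, rfl⟩
  have hinv : (E : Matrix N N ℂ)⁻¹ = star (E : Matrix N N ℂ) :=
    Matrix.inv_eq_right_inv (Matrix.mem_unitaryGroup_iff.mp E.2)
  have h1 : Complex.I • K = (E : Matrix N N ℂ) *
      Matrix.diagonal (fun j => (hK.eigenvalues j * Complex.I : ℂ)) * (E : Matrix N N ℂ)⁻¹ := by
    conv_lhs => rw [hK.spectral_theorem]
    rw [Unitary.conjStarAlgAut_apply, hinv, ← smul_mul_assoc, ← mul_smul_comm, ← Matrix.diagonal_smul]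
    congr 3
    ext j
    simp [mul_comm]
  have h2 : NormedSpace.exp (Complex.I • K) * (E : Matrix N N ℂ) =
      E * Matrix.diagonal (fun j => Complex.exp (hK.eigenvalues j * Complex.I)) := by
    rw [h1, Matrix.exp_conj _ _ hu, Matrix.exp_diagonal, mul_assoc,
      Matrix.nonsing_inv_mul _ ((Matrix.isUnit_iff_isUnit_det _).mp hu), mul_one]
    congr 2
    ext j
    rw [Pi.coe_exp, Complex.exp_eq_exp_ℂ]
  ext i
  have h3 := congrFun (congrFun h2 i) j
  rw [Matrix.mul_diagonal, mul_comm] at h3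
  exact h3

lemma norm_sq_I_smul {K : Matrix N N ℂ} (hK : K.IsHermitian) :
    ‖Complex.I • K‖ ^ 2 = ∑ j, hK.eigenvalues j ^ 2 := by
  rw [norm_smul, Complex.norm_I, one_mul, ← sum_norm_sq_evalCLM hK]
  refine Finset.sum_congr rfl fun j _ => ?_
  rw [evalCLM_apply, hK.mulVec_eigenvectorBasis, WithLp.toLp_smul, norm_smul, Real.norm_eq_abs,
    hK.eigenvectorBasis.orthonormal.1, mul_one, sq_abs]

/-- The principal logarithm is not longer than a curve with the same end points: the images of an
orthonormal eigenbasis describe curves on the unit sphere, whose lengths are at least the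
eigenangles. -/
lemma norm_principalLog_le_curveLength {p q : Matrix.unitaryGroup N ℂ} {γ : ℝ → Matrix N N ℂ}
    (hγ : IsCurveJoining p q γ) : ‖(principalLog (p⁻¹ * q) : Matrix N N ℂ)‖ ≤ curveLength γ := by
  obtain ⟨K, hK, hspec, hexp, hv⟩ := isPrincipalLog_principalLog (p⁻¹ * q)
  set v : Matrix N N ℂ := (principalLog (p⁻¹ * q)).1
  set θ := hK.eigenvalues with hθ
  set e := hK.eigenvectorBasis with he
  set f : N → EuclideanSpace ℂ N := fun j => evalCLM (e j) p with hf
  have hf1 : ∀ j, ‖f j‖ = 1 := fun j => by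
    rw [hf, norm_evalCLM_unitary _ p.2, e.orthonormal.1]
  have hvn : ‖v‖ ^ 2 = ∑ j, |θ j| ^ 2 := by
    rw [hv, norm_sq_I_smul hK]; simp only [sq_abs, hθ]
  set Φ : ℝ → ℝ → ℝ := fun r t =>
    ∑ j, |θ j| * Real.arccos (r * RCLike.re (inner ℂ (f j) (evalCLM (e j) (γ t)))) with hΦ
  have hbound : ∀ r ∈ Ico (0 : ℝ) 1, Φ r 1 - Φ r 0 ≤ ‖v‖ * curveLength γ := by
    intro r hr
    refine hγ.sub_le_mul_curveLength ?_ fun t ht hd => ?_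
    · refine continuousOn_finsetSum _ fun j _ => continuousOn_const.mul ?_
      refine Real.continuous_arccos.comp_continuousOn (continuousOn_const.mul ?_)
      refine RCLike.continuous_re.comp_continuousOn (continuousOn_const.inner ?_)
      exact (evalCLM (e j)).continuous.comp_continuousOn hγ.continuousOn
    · have hj : ∀ j, ∃ a, HasDerivAt (fun s => Real.arccos
          (r * RCLike.re (inner ℂ (f j) (evalCLM (e j) (γ s))))) a t ∧
            a ≤ ‖evalCLM (e j) (deriv γ t)‖ := by
        intro j
        refine exists_hasDerivAt_arccos_le hr.1 hr.2 (hf1 j) ?_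
          ((evalCLM (e j)).hasFDerivAt.comp_hasDerivAt t hd.hasDerivAt)
        filter_upwards [Icc_mem_nhds ht.1 ht.2] with s hs
        rw [norm_evalCLM_unitary _ (hγ.mem_unitaryGroup s hs),
          e.orthonormal.1]
      choose a ha hle using hj
      refine ⟨∑ j, |θ j| * a j, HasDerivAt.fun_sum fun j _ => (ha j).const_mul _, ?_⟩
      calc ∑ j, |θ j| * a j ≤ ∑ j, |θ j| * ‖evalCLM (e j) (deriv γ t)‖ :=
            Finset.sum_le_sum fun j _ => mul_le_mul_of_nonneg_left (hle j) (abs_nonneg _)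
        _ ≤ √(∑ j, |θ j| ^ 2) * √(∑ j, ‖evalCLM (e j) (deriv γ t)‖ ^ 2) :=
            Real.sum_mul_le_sqrt_mul_sqrt _ _ _
        _ = ‖v‖ * ‖deriv γ t‖ := by
            rw [← hvn, sum_norm_sq_evalCLM, Real.sqrt_sq (norm_nonneg _),
              Real.sqrt_sq (norm_nonneg _)]
  -- The bound does not depend on `r`, and `arccos` is continuous up to `±1`.
  have hlim : Φ 1 1 - Φ 1 0 ≤ ‖v‖ * curveLength γ := by
    have hcont : Continuous fun r => Φ r 1 - Φ r 0 := by
      have := Real.continuous_arccos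
      simp only [hΦ]
      fun_prop
    have hc : Filter.Tendsto (fun r => Φ r 1 - Φ r 0) (nhdsWithin 1 (Iio 1))
        (nhds (Φ 1 1 - Φ 1 0)) := (hcont.tendsto 1).mono_left nhdsWithin_le_nhds
    refine le_of_tendsto hc ?_
    filter_upwards [Ico_mem_nhdsLT zero_lt_one] with r hr using hbound r hr
  have hΦ0 : Φ 1 0 = 0 := by
    refine Finset.sum_eq_zero fun j _ => ?_
    rw [hγ.source, one_mul]
    have : inner ℂ (f j) (evalCLM (e j) (p : Matrix N N ℂ)) = 1 := by
      rw [show evalCLM (e j) (p : Matrix N N ℂ) = f j from rfl,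
        inner_self_eq_norm_sq_to_K, hf1]
      simp
    rw [this, RCLike.one_re, Real.arccos_one, mul_zero]
  have hΦ1 : Φ 1 1 = ‖v‖ ^ 2 := by
    rw [hvn]
    refine Finset.sum_congr rfl fun j _ => ?_
    have hq : evalCLM (e j) (q : Matrix N N ℂ) = Complex.exp (θ j * Complex.I) • f j := by
      have h1 : (q : Matrix N N ℂ) = p * NormedSpace.exp (Complex.I • K) := by
        rw [hexp, ← Submonoid.coe_mul, mul_inv_cancel_left]
      have h2 : NormedSpace.exp (Complex.I • K) *ᵥ (e j).ofLp =
          (Complex.exp (θ j * Complex.I) • e j).ofLp :=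
        congrArg WithLp.ofLp (evalCLM_exp_eigenvectorBasis hK j)
      rw [show f j = evalCLM (e j) p from rfl, evalCLM_apply, evalCLM_apply, h1,
        ← Matrix.mulVec_mulVec]
      rw [h2, WithLp.ofLp_smul, Matrix.mulVec_smul, WithLp.toLp_smul]
    -- Principality enters here: `|θⱼ| ≤ π` gives `arccos (cos |θⱼ|) = |θⱼ|`.
    have hm := hspec (hK.eigenvalues_mem_spectrum_real j)
    rw [hγ.target, hq, inner_smul_right, inner_self_eq_norm_sq_to_K, hf1, one_mul]
    simp only [RCLike.ofReal_one, one_pow, mul_one]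
    rw [show (RCLike.re (Complex.exp (θ j * Complex.I)) : ℝ) = Real.cos |θ j| by
      rw [Real.cos_abs]; exact Complex.exp_ofReal_mul_I_re _,
      Real.arccos_cos (abs_nonneg _) (abs_le.mpr ⟨hm.1.le, hm.2⟩), sq]
  rw [hΦ0, hΦ1, sub_zero, sq] at hlim
  rcases (norm_nonneg v).eq_or_lt with h | h
  · rw [← h]; exact curveLength_nonneg γ
  · exact le_of_mul_le_mul_left hlim h

lemma norm_principalLog_le_riemannianDist (p q : Matrix.unitaryGroup N ℂ) :
    ‖(principalLog (p⁻¹ * q) : Matrix N N ℂ)‖ ≤ riemannianDist p q := by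
  obtain ⟨γ, hγ⟩ := exists_isCurveJoining p q
  refine le_csInf ⟨_, γ, hγ, rfl⟩ ?_
  rintro _ ⟨γ, hγ, rfl⟩
  exact norm_principalLog_le_curveLength hγ

/-! ### The tangent component and the descent step -/

/-- Pythagoras for the tangent component. -/
lemma norm_sq_sub_tangentPart (m n : ℕ) (v : lieU (Sym (Fin m) n)) :
    ‖(v : Matrix (Sym (Fin m) n) (Sym (Fin m) n) ℂ) - tangentPart m n v‖ ^ 2 =
      ‖(v : Matrix (Sym (Fin m) n) (Sym (Fin m) n) ℂ)‖ ^ 2 -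
        ‖(tangentPart m n v : Matrix (Sym (Fin m) n) (Sym (Fin m) n) ℂ)‖ ^ 2 := by
  have hc := isCompl_orthogonal (imageAlgebra m n)
  have h1 : tangentPart m n v ∈ imageAlgebra m n := Submodule.projection_apply_mem hc v
  have h2 : v - tangentPart m n v ∈ (lieInner _).orthogonal (imageAlgebra m n) :=
    Submodule.projection_eq_self_sub_projection hc v ▸ Submodule.projection_apply_mem hc.symm v
  have h3 : metricForm _ (tangentPart m n v : Matrix (Sym (Fin m) n) (Sym (Fin m) n) ℂ)
      ((v : Matrix (Sym (Fin m) n) (Sym (Fin m) n) ℂ) - tangentPart m n v) = 0 := h2 _ h1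
  simp only [← metricForm_self_eq_norm_sq]
  rw [map_sub] at h3
  simp only [map_sub, LinearMap.sub_apply]
  rw [metricForm_comm (v : Matrix (Sym (Fin m) n) (Sym (Fin m) n) ℂ) (tangentPart m n v)]
  linarith

lemma norm_sub_tangentPart_le {m n : ℕ} (v : lieU (Sym (Fin m) n)) :
    ‖(v : Matrix (Sym (Fin m) n) (Sym (Fin m) n) ℂ) - tangentPart m n v‖ ≤
      ‖(v : Matrix (Sym (Fin m) n) (Sym (Fin m) n) ℂ)‖ :=
  (le_abs_self _).trans (abs_le_of_sq_le_sq
    ((norm_sq_sub_tangentPart m n v).trans_le (sub_le_self _ (sq_nonneg _))) (norm_nonneg _))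

lemma tangentPart_eq_zero_of_norm_le {m n : ℕ} {v : lieU (Sym (Fin m) n)}
    (h : ‖(v : Matrix (Sym (Fin m) n) (Sym (Fin m) n) ℂ)‖ ≤
      ‖(v : Matrix (Sym (Fin m) n) (Sym (Fin m) n) ℂ) - tangentPart m n v‖) :
    tangentPart m n v = 0 := by
  have hp := norm_sq_sub_tangentPart m n v
  rw [(norm_sub_tangentPart_le v).antisymm h, eq_comm, sub_eq_self, sq_eq_zero_iff,
    norm_eq_zero] at hp
  exact Subtype.ext hp

end LinearOptics

theorem mainTheorem3 (m n : ℕ) (U : Matrix.unitaryGroup (Sym (Fin m) n) ℂ) (i : ℕ) :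
    LinearOptics.riemannianDist (LinearOptics.approxSeq m n U (i + 1)) U ≤
        LinearOptics.riemannianDist (LinearOptics.approxSeq m n U i) U ∧
      (LinearOptics.riemannianDist (LinearOptics.approxSeq m n U (i + 1)) U =
          LinearOptics.riemannianDist (LinearOptics.approxSeq m n U i) U ↔
        LinearOptics.approxSeq m n U (i + 1) = LinearOptics.approxSeq m n U i) := by
  have hstep : LinearOptics.approxSeq m n U (i + 1) = LinearOptics.approxSeq m n U i *
      LinearOptics.expU (LinearOptics.tangentPart m n
        (LinearOptics.principalLog ((LinearOptics.approxSeq m n U i)⁻¹ * U))) := rfl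
  -- Only the relation `hstep` between consecutive terms matters, so both become arbitrary
  -- unitaries.
  generalize LinearOptics.approxSeq m n U (i + 1) = q at *
  generalize LinearOptics.approxSeq m n U i = p at *
  have hlow := LinearOptics.norm_principalLog_le_riemannianDist p U
  have hU : p * LinearOptics.expU (LinearOptics.principalLog (p⁻¹ * U)) = U := by
    rw [LinearOptics.expU_principalLog, mul_inv_cancel_left]
  generalize LinearOptics.principalLog (p⁻¹ * U) = v at *
  have hup := LinearOptics.riemannianDist_mul_expU_le p (LinearOptics.tangentPart m n v) v
  rw [hU, ← hstep] at hup
  refine ⟨hup.trans ((LinearOptics.norm_sub_tangentPart_le v).trans hlow), fun h => ?_,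
    fun h => by rw [h]⟩
  -- Equality of the distances closes the chain: `‖v‖ ≤ d(p, U) = d(q, U) ≤ ‖v - v_T‖`.
  rw [hstep, LinearOptics.tangentPart_eq_zero_of_norm_le (hlow.trans (h.symm.le.trans hup))]
  refine mul_eq_left.mpr (Subtype.ext ?_)
  simp [LinearOptics.expU]
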